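/- Let $\mathbb{S}\subset\mathbb{R}$ be a finite set and let $Y=(Y_t)_{t\ge 0}$ be a càdlàg continuous-time Markov chain on $\mathbb{S}$ with transition rate matrix $G=(G(x,z))_{x,z\in\mathbb{S}}$, i.e. $G(x,z)\ge 0$ for $z\ne x$, $G(x,x)=-\sum_{z\ne x}G(x,z)$, and the transition function of $Y$ is $e^{tG}$. For $x\le y$ in $\mathbb{S}$, conditioning on $Y_0=x,\ \overline Y_0=y$ means that $Y$ starts at $x$ and the running maximum is $\overline Y_t=y\vee\sup_{0\le u\le t}Y_u$; write $\mathbb{E}_x[\cdot]=\mathbb{E}[\cdot\mid Y_0=x,\overline Y_0=x]$. For $A\subseteq\mathbb{R}$ let $T_A=\inf\{t>0: Y_t\notin A\}$ (with $\inf\emptyset=\infty$), and put $T_r^+=T_{(-\infty,r]}$, $T_\ell^-=T_{(\ell,\infty)}$. Fix $a>0$ and $f:\mathbb{S}\to\mathbb{R}$, let $\tau_a=\inf\{t\ge 0:\overline Y_t-Y_t\ge a\}$, and let $k:\mathbb{S}^2\to\mathbb{C}$ satisfy $\Re k(x,y)\ge 0$ for all $x,y\in\mathbb{S}$. Define $$C(k,x)=\mathbb{E}_x\Big[e^{-\int_0^{\tau_a}k(Y_s,\overline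 Y_s)\,ds}\,\mathbf 1_{\{\tau_a<\infty\}}f(Y_{\tau_a})\Big],$$ $$P_A(\kappa,x;h)=\mathbb{E}\Big[e^{-\int_0^{T_A}\kappa(Y_s)\,ds}\,\mathbf 1_{\{T_A<\infty\}}h(Y_{T_A})\,\Big|\,Y_0=x\Big],\qquad \kappa:\mathbb{S}\to\mathbb{C},\ h:\mathbb{S}\to\mathbb{R},$$ $$S_{(\ell,r]}(k,x,y;g)=\mathbb{E}\Big[e^{-\int_0^{T_r^+}k(Y_s,\overline Y_s)\,ds}\,\mathbf 1_{\{T_\ell^->T_r^+\}}g(Y_{T_r^+})\,\Big|\,Y_0=x,\overline Y_0=y\Big],\qquad g:\mathbb{S}\to\mathbb{R}.$$ Then the random variables whose expectations occur below are integrable, and the following hold. (i) For every $x\in\mathbb{S}$, $$C(k,x)=P_{(x-a,x]}\big(k(\cdot,x),x;f(\cdot)\mathbf 1_{\{\cdot\le x-a\}}\big)+\sum_{z\in\mathbb{S},\,z>x}S_{(x-a,x]}\big(k,x,x;\mathbf 1_{\{\cdot=z\}}\big)\,C(k,z).$$ (ii) For all reals $\ell<r$, all $g:\mathbb{S}\to\mathbb{R}$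 and all $x,y\in\mathbb{S}$ with $x\le y$, $$\begin{cases}k(x,y)\,S_{(\ell,r]}(k,x,y;g)-\sum_{z\in\mathbb{S}}G(x,z)\,S_{(\ell,r]}(k,z,y\vee z;g)=0,& x\in(\ell,r],\\ S_{(\ell,r]}(k,x,y;g)=g(x)\mathbf 1_{\{x>r\}},& x\notin(\ell,r].\end{cases}$$ -/

import Mathlib

open MeasureTheory Set
open scoped NNReal ENNReal Topology

namespace DrawdownCTMC

/-- `G` is a transition rate matrix on the finite state space `S ⊆ ℝ`: nonnegative off-diagonal
entries, and `G(x,x) = -∑_{y ≠ x} G(x,y)`. -/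
structure IsRateMatrix {S : Finset ℝ} (G : Matrix S S ℝ) : Prop where
  offDiag_nonneg : ∀ x y, x ≠ y → 0 ≤ G x y
  diag_eq : ∀ x, G x x = -∑ y ∈ Finset.univ.erase x, G x y

/-- `Y` is a continuous-time Markov chain on `S` with transition rate matrix `G`, where `P x` is
the probability law under which the chain starts at `x`: the paths are càdlàg and the
finite-dimensional distributions are those of the Markov transition function `exp (t G)`, i.e.
`P_{x₀}(Y_{t₀} = x₀, …, Y_{tₙ} = xₙ) = ∏ᵢ exp((t_{i+1} - t_i) G)(x_i, x_{i+1})`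
for `0 = t₀ ≤ t₁ ≤ … ≤ tₙ`. -/
structure IsCTMC {S : Finset ℝ} {Ω : Type*} [MeasurableSpace Ω] (G : Matrix S S ℝ)
    (P : S → Measure Ω) (Y : ℝ≥0 → Ω → S) : Prop where
  isRateMatrix : IsRateMatrix G
  isProbabilityMeasure : ∀ x, IsProbabilityMeasure (P x)
  measurable : ∀ t, Measurable (Y t)
  rightContinuous : ∀ ω t, ContinuousWithinAt (fun s => Y s ω) (Ici t) t
  leftLimits : ∀ ω t, ∃ z : S, Filter.Tendsto (fun s => Y s ω) (𝓝[<] t) (𝓝 z)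
  finiteDimensional : ∀ (n : ℕ) (t : Fin (n + 1) → ℝ≥0) (x : Fin (n + 1) → S),
    Monotone t → t 0 = 0 →
      (P (x 0)).real {ω | ∀ i, Y (t i) ω = x i} =
        ∏ i : Fin n, NormedSpace.exp (((t i.succ : ℝ) - (t i.castSucc : ℝ)) • G)
          (x i.castSucc) (x i.succ)

section Functionals

variable {S : Finset ℝ} {Ω : Type*}

open Classical in
/-- The running maximum at time `t`, when its value at time `0` is prescribed to be `y`:
the largest element of `{y} ∪ {Y_u : 0 ≤ u ≤ t}`. -/
noncomputable def runMax (Y : ℝ≥0 → Ω → S) (y : S) (t : ℝ≥0) (ω : Ω) : S :=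
  (insert y (Finset.univ.filter fun z : S => ∃ u ≤ t, Y u ω = z)).max'
    (Finset.insert_nonempty _ _)

/-- First passage time `T_A = inf {t > 0 : Y_t ∉ A}`, with value `∞` if there is no such `t`. -/
noncomputable def passageTime (Y : ℝ≥0 → Ω → S) (A : Set ℝ) (ω : Ω) : ℝ≥0∞ :=
  sInf ((fun t : ℝ≥0 => (t : ℝ≥0∞)) '' {t | 0 < t ∧ (Y t ω : ℝ) ∉ A})

/-- `T_r⁺ = T_{(-∞, r]}`. -/
noncomputable def upTime (Y : ℝ≥0 → Ω → S) (r : ℝ) : Ω → ℝ≥0∞ := passageTime Y (Iic r)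

/-- `T_ℓ⁻ = T_{(ℓ, ∞)}`. -/
noncomputable def downTime (Y : ℝ≥0 → Ω → S) (l : ℝ) : Ω → ℝ≥0∞ := passageTime Y (Ioi l)

/-- The drawdown time `τ_a = inf {t ≥ 0 : Ȳ_t - Y_t ≥ a}`, where `Ȳ₀ = y`. -/
noncomputable def drawdownTime (Y : ℝ≥0 → Ω → S) (y : S) (a : ℝ) (ω : Ω) : ℝ≥0∞ :=
  sInf ((fun t : ℝ≥0 => (t : ℝ≥0∞)) '' {t | a ≤ (runMax Y y t ω : ℝ) - (Y t ω : ℝ)})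

open Classical in
/-- The random variable `exp(-∫₀^{T_A} k(Y_s) ds) 1{T_A < ∞} f(Y_{T_A})`. -/
noncomputable def passageVar (Y : ℝ≥0 → Ω → S) (A : Set ℝ) (k : S → ℂ) (f : S → ℝ)
    (ω : Ω) : ℂ :=
  if passageTime Y A ω < ∞ then
    Complex.exp (-∫ s in (0 : ℝ)..(passageTime Y A ω).toReal, k (Y s.toNNReal ω)) *
      (f (Y (passageTime Y A ω).toNNReal ω) : ℂ)
  else 0

open Classical in
/-- The random variable `exp(-∫₀^{τ_a} k(Y_s, Ȳ_s) ds) 1{τ_a < ∞} f(Y_{τ_a})`, with `Ȳ₀ = y`. -/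
noncomputable def drawdownVar (Y : ℝ≥0 → Ω → S) (y : S) (a : ℝ) (k : S → S → ℂ) (f : S → ℝ)
    (ω : Ω) : ℂ :=
  if drawdownTime Y y a ω < ∞ then
    Complex.exp (-∫ s in (0 : ℝ)..(drawdownTime Y y a ω).toReal,
        k (Y s.toNNReal ω) (runMax Y y s.toNNReal ω)) *
      (f (Y (drawdownTime Y y a ω).toNNReal ω) : ℂ)
  else 0

open Classical in
/-- The random variable `exp(-∫₀^{T_r⁺} k(Y_s, Ȳ_s) ds) 1{T_ℓ⁻ > T_r⁺} g(Y_{T_r⁺})`,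
with `Ȳ₀ = y`. -/
noncomputable def upcrossVar (Y : ℝ≥0 → Ω → S) (y : S) (l r : ℝ) (k : S → S → ℂ) (g : S → ℝ)
    (ω : Ω) : ℂ :=
  if upTime Y r ω < downTime Y l ω then
    Complex.exp (-∫ s in (0 : ℝ)..(upTime Y r ω).toReal,
        k (Y s.toNNReal ω) (runMax Y y s.toNNReal ω)) *
      (g (Y (upTime Y r ω).toNNReal ω) : ℂ)
  else 0

variable [MeasurableSpace Ω]

/-- `P_A(k, x; f) = E[exp(-∫₀^{T_A} k(Y_s) ds) 1{T_A < ∞} f(Y_{T_A}) | Y₀ = x]`. -/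
noncomputable def passageP (P : S → Measure Ω) (Y : ℝ≥0 → Ω → S) (A : Set ℝ) (k : S → ℂ)
    (x : S) (f : S → ℝ) : ℂ :=
  ∫ ω, passageVar Y A k f ω ∂(P x)

/-- `C(k, x) = E[exp(-∫₀^{τ_a} k(Y_s, Ȳ_s) ds) 1{τ_a < ∞} f(Y_{τ_a}) | Y₀ = x, Ȳ₀ = x]`. -/
noncomputable def drawdownC (P : S → Measure Ω) (Y : ℝ≥0 → Ω → S) (a : ℝ) (f : S → ℝ)
    (k : S → S → ℂ) (x : S) : ℂ :=
  ∫ ω, drawdownVar Y x a k f ω ∂(P x)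

/-- `S_{(ℓ, r]}(k, x, y; g)
  = E[exp(-∫₀^{T_r⁺} k(Y_s, Ȳ_s) ds) 1{T_ℓ⁻ > T_r⁺} g(Y_{T_r⁺}) | Y₀ = x, Ȳ₀ = y]`. -/
noncomputable def upcrossS (P : S → Measure Ω) (Y : ℝ≥0 → Ω → S) (l r : ℝ) (k : S → S → ℂ)
    (x y : S) (g : S → ℝ) : ℂ :=
  ∫ ω, upcrossVar Y y l r k g ω ∂(P x)

end Functionals

end DrawdownCTMC

open DrawdownCTMC

/-! Every functional in the statement is a discounted payoff `exitVar` at the first exit of (Y, Ȳ)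
from a region `D` that is decreasing in the maximum. The strong Markov property is never invoked;
its role is taken by a generator equation and a uniqueness argument.

Sample the path at mesh h. The finite-dimensional distributions give the skeleton payoff means u_h a
one-step recursion (`IsCTMC.integral_seqExitVar_eq`) with kernel exp(hG)(x,z) e^{-h k(z, y ∨ z)}.
Right-continuity gives pathwise convergence of the skeleton payoffs as h → 0
(`RightConst.tendsto_seqExitVar`), and Re k ≥ 0 gives a uniform bound, so u_h converges to
`exitMean`. Dividing the recursion by h and letting h → 0 yields k w = G w inside `D`
(`IsCTMC.exitMean_generator`). With the boundary values this is (ii).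

For (i), let the start z vary with initial maximum x ∨ z. Both sides then solve the same linear
system on (x-a, x] and agree outside it, so they coincide by a maximum principle
(`IsRateMatrix.eq_zero_of_generator`). That needs Re k > 0; the general case follows by replacing k
with k + δ and letting δ ↓ 0. -/

namespace DrawdownCTMC

/-! ### Exit payoffs of discrete sequences. -/

section Sequences

variable {α : Type*} [LinearOrder α]

/-- The running maximum of the sequence `z 1, z 2, …`, started from the value `y`. -/
def seqMax (y : α) (z : ℕ → α) : ℕ → α
  | 0 => y
  | j + 1 => seqMax y z j ⊔ z (j + 1)

lemma seqMax_succ_eq_tail (y : α) (z : ℕ → α) (j : ℕ) :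
    seqMax y z (j + 1) = seqMax (y ⊔ z 1) (fun i => z (i + 1)) j := by
  induction j with
  | zero => rfl
  | succ j ih =>
    rw [seqMax, ih]
    rfl

lemma le_seqMax_start (y : α) (z : ℕ → α) (j : ℕ) : y ≤ seqMax y z j := by
  induction j with
  | zero => exact le_rfl
  | succ j ih => exact ih.trans le_sup_left

lemma le_seqMax {y : α} {z : ℕ → α} (h0 : z 0 ≤ y) {i j : ℕ} (hij : i ≤ j) :
    z i ≤ seqMax y z j := by
  induction j with
  | zero =>
    obtain rfl : i = 0 := by omega
    exact h0
  | succ j ih =>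
    rcases Nat.lt_or_ge i (j + 1) with h | h
    · exact (ih (by omega)).trans le_sup_left
    · obtain rfl : i = j + 1 := by omega
      exact le_sup_right

lemma seqMax_le {y b : α} {z : ℕ → α} {j : ℕ} (hy : y ≤ b) (hz : ∀ i ≤ j, z i ≤ b) :
    seqMax y z j ≤ b := by
  induction j with
  | zero => exact hy
  | succ j ih => exact sup_le (ih fun i hi => hz i (by omega)) (hz _ le_rfl)

variable (h : ℝ) (D : α → α → Prop) (k : α → α → ℂ) (g : α → ℝ)

open Classical in
/-- The discounted payoff of a sequence at its first exit from `D`, where the second component is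
the running maximum, and `0` if the sequence does not exit. -/
noncomputable def seqExitVar (y : α) (z : ℕ → α) : ℂ :=
  if H : ∃ j, ¬ D (z j) (seqMax y z j) then
    Complex.exp (-(h * ∑ i ∈ Finset.range (Nat.find H), k (z (i + 1)) (seqMax y z (i + 1)))) *
      (g (z (Nat.find H)) : ℂ)
  else 0

open Classical in
/-- The discounted payoff at the first exit from `D`, for paths of length `N`. -/
noncomputable def truncExitVar : ∀ N : ℕ, α → (Fin (N + 1) → α) → ℂ
  | 0, y, p => if D (p 0) y then 0 else (g (p 0) : ℂ)
  | N + 1, y, p =>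
    if D (p 0) y then
      Complex.exp (-(h * k (Fin.tail p 0) (y ⊔ Fin.tail p 0))) *
        truncExitVar N (y ⊔ Fin.tail p 0) (Fin.tail p)
    else (g (p 0) : ℂ)

variable {h D k g}

lemma seqExitVar_eq {y : α} {z : ℕ → α} {J : ℕ} (hlt : ∀ i < J, D (z i) (seqMax y z i))
    (hJ : ¬ D (z J) (seqMax y z J)) :
    seqExitVar h D k g y z =
      Complex.exp (-(h * ∑ i ∈ Finset.range J, k (z (i + 1)) (seqMax y z (i + 1)))) *
        (g (z J) : ℂ) := by
  classical
  have H : ∃ j, ¬ D (z j) (seqMax y z j) := ⟨J, hJ⟩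
  have hf : Nat.find H = J := by
    rw [Nat.find_eq_iff]
    exact ⟨hJ, fun i hi => not_not.2 (hlt i hi)⟩
  unfold seqExitVar
  rw [dif_pos H]
  have : ∀ m, m = J → Complex.exp (-(h * ∑ i ∈ Finset.range m,
      k (z (i + 1)) (seqMax y z (i + 1)))) * (g (z m) : ℂ) = Complex.exp (-(h *
      ∑ i ∈ Finset.range J, k (z (i + 1)) (seqMax y z (i + 1)))) * (g (z J) : ℂ) := by
    rintro m rfl
    rfl
  exact this _ (by convert hf)

lemma seqExitVar_eq_zero {y : α} {z : ℕ → α} (hD : ∀ i, D (z i) (seqMax y z i)) :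
    seqExitVar h D k g y z = 0 :=
  dif_neg (by push Not; exact hD)

/-- Peeling off the first step shifts the sequence and absorbs `z 1` into the starting maximum, so
the recursive form unrolls to the closed form. The recursive form is the one suited to the Markov
property, the closed form to the limit h → 0. -/
lemma truncExitVar_eq {J : ℕ} : ∀ {y : α} {z : ℕ → α}, (∀ i < J, D (z i) (seqMax y z i)) →
    (¬ D (z J) (seqMax y z J)) → ∀ {N : ℕ}, J ≤ N →
    truncExitVar h D k g N y (fun i => z i) =
      Complex.exp (-(h * ∑ i ∈ Finset.range J, k (z (i + 1)) (seqMax y z (i + 1)))) *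
        (g (z J) : ℂ) := by
  induction J with
  | zero =>
    intro y z _ hJ N _
    have hJ' : ¬ D (z 0) y := hJ
    cases N <;> simp [truncExitVar, hJ']
  | succ J ih =>
    intro y z hlt hJ N hN
    obtain ⟨N, rfl⟩ : ∃ M, N = M + 1 := ⟨N - 1, by omega⟩
    have h0 : D (z 0) y := hlt 0 (by omega)
    have := ih (y := y ⊔ z 1) (z := fun i => z (i + 1))
      (fun i hi => by simpa only [← seqMax_succ_eq_tail] using hlt (i + 1) (by omega))
      (by simpa only [← seqMax_succ_eq_tail] using hJ) (N := N) (by omega)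
    have ht : Fin.tail (fun i : Fin (N + 1 + 1) => z i) = fun i : Fin (N + 1) => z (i + 1) := by
      ext i
      simp [Fin.tail]
    rw [truncExitVar, ht, if_pos (by simpa using h0)]
    simp only [← seqMax_succ_eq_tail] at this
    simp only [Fin.val_zero, zero_add]
    rw [this, ← mul_assoc, ← Complex.exp_add, Finset.sum_range_succ' _ J]
    congr 2
    simp only [seqMax, zero_add]
    ring

lemma truncExitVar_eq_zero : ∀ (N : ℕ) {y : α} {z : ℕ → α}, (∀ i, D (z i) (seqMax y z i)) →
    truncExitVar h D k g N y (fun i => z i) = 0 := by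
  intro N
  induction N with
  | zero =>
    intro y z hD
    have h0 : D (z 0) y := hD 0
    simp [truncExitVar, h0]
  | succ N ih =>
    intro y z hD
    have h0 : D (z 0) y := hD 0
    have ht : Fin.tail (fun i : Fin (N + 1 + 1) => z i) = fun i : Fin (N + 1) => z (i + 1) := by
      ext i
      simp [Fin.tail]
    rw [truncExitVar, ht, if_pos (by simpa using h0)]
    simp only [Fin.val_zero, zero_add]
    rw [ih (y := y ⊔ z 1) (z := fun i => z (i + 1))
      (fun i => by simpa only [← seqMax_succ_eq_tail] using hD (i + 1)), mul_zero]

lemma tendsto_truncExitVar (y : α) (z : ℕ → α) :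
    Filter.Tendsto (fun N => truncExitVar h D k g N y (fun i => z i)) Filter.atTop
      (𝓝 (seqExitVar h D k g y z)) := by
  classical
  by_cases H : ∃ j, ¬ D (z j) (seqMax y z j)
  · have h1 : ∀ i < Nat.find H, D (z i) (seqMax y z i) := fun i hi => not_not.1 (Nat.find_min H hi)
    have h2 := Nat.find_spec H
    rw [seqExitVar_eq h1 h2]
    refine tendsto_const_nhds.congr' ?_
    filter_upwards [Filter.eventually_ge_atTop (Nat.find H)] with N hN
    rw [truncExitVar_eq h1 h2 hN]
  · push Not at H
    simp only [seqExitVar_eq_zero H, truncExitVar_eq_zero _ H]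
    exact tendsto_const_nhds

/-- Each discount factor has modulus at most 1. The bound is uniform in the length and in the mesh,
and dominates every later passage to the limit. -/
lemma norm_truncExitVar_le {B : ℝ} (h0 : 0 ≤ h) (hk : ∀ x y, 0 ≤ (k x y).re)
    (hB : 0 ≤ B) (hg : ∀ x, |g x| ≤ B) :
    ∀ (N : ℕ) (y : α) (p : Fin (N + 1) → α), ‖truncExitVar h D k g N y p‖ ≤ B := by
  intro N
  induction N with
  | zero =>
    intro y p
    unfold truncExitVar
    split_ifs
    · simpa using hB
    · simpa using hg _
  | succ N ih =>
    intro y p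
    unfold truncExitVar
    split_ifs
    · rw [norm_mul, Complex.norm_exp]
      have : Real.exp (-(h * k (Fin.tail p 0) (y ⊔ Fin.tail p 0))).re ≤ 1 := by
        rw [Real.exp_le_one_iff]
        simpa using mul_nonneg h0 (hk _ _)
      calc _ ≤ 1 * B := mul_le_mul this (ih _ _) (norm_nonneg _) zero_le_one
        _ = B := one_mul B
    · simpa using hg _

lemma norm_seqExitVar_le {B : ℝ} (h0 : 0 ≤ h) (hk : ∀ x y, 0 ≤ (k x y).re)
    (hB : 0 ≤ B) (hg : ∀ x, |g x| ≤ B) (y : α) (z : ℕ → α) :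
    ‖seqExitVar h D k g y z‖ ≤ B :=
  le_of_tendsto (tendsto_truncExitVar y z).norm
    (Filter.Eventually.of_forall fun _ => norm_truncExitVar_le h0 hk hB hg _ _ _)

end Sequences

/-! ### The law of the skeleton and its one-step Markov property. -/

section Skeleton

variable {S : Finset ℝ} {Ω : Type*} [MeasurableSpace Ω] {G : Matrix S S ℝ}
  {P : S → Measure Ω} {Y : ℝ≥0 → Ω → S}

lemma IsCTMC.ae_zero (hY : IsCTMC G P Y) (x : S) : ∀ᵐ ω ∂(P x), Y 0 ω = x := by
  have := hY.isProbabilityMeasure x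
  have h := hY.finiteDimensional 0 (fun _ => 0) (fun _ => x) monotone_const rfl
  simp only [forall_const, Finset.univ_eq_empty, Finset.prod_empty] at h
  have hm : MeasurableSet {ω | Y 0 ω = x} := hY.measurable 0 (measurableSet_singleton x)
  rw [ae_iff]
  refine (prob_compl_eq_zero_iff hm).2 ?_
  rwa [measureReal_def, ENNReal.toReal_eq_one_iff] at h

lemma IsCTMC.real_skeleton_eq (hY : IsCTMC G P Y) (h : ℝ≥0) (x : S) (n : ℕ)
    (p : Fin (n + 1) → S) :
    (P x).real {ω | (fun i : Fin (n + 1) => Y ((i : ℕ) * h) ω) = p} =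
      if p 0 = x then ∏ i : Fin n, NormedSpace.exp ((h : ℝ) • G) (p i.castSucc) (p i.succ)
      else 0 := by
  have := hY.isProbabilityMeasure x
  split_ifs with hx
  · have := hY.finiteDimensional n (fun i => (i : ℕ) * h) p
      (fun i j hij => mul_le_mul_left (Nat.cast_le.2 hij) h) (by simp)
    rw [hx] at this
    simp only [funext_iff]
    rw [this]
    refine Finset.prod_congr rfl fun i _ => ?_
    push_cast [Fin.val_succ, Fin.val_castSucc]
    ring_nf
  · rw [measureReal_eq_zero_iff]
    refine measure_mono_null ?_ (ae_iff.1 (hY.ae_zero x))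
    intro ω hω h0
    apply hx
    rw [← hω]
    simpa using h0

lemma IsCTMC.measurable_skeleton (hY : IsCTMC G P Y) (h : ℝ≥0) (n : ℕ) :
    Measurable fun ω => (fun i : Fin (n + 1) => Y ((i : ℕ) * h) ω) :=
  measurable_pi_lambda _ fun _ => hY.measurable _

lemma IsCTMC.integral_skeleton (hY : IsCTMC G P Y) (h : ℝ≥0) (x : S) (n : ℕ)
    (Φ : (Fin (n + 1) → S) → ℂ) :
    ∫ ω, Φ (fun i => Y ((i : ℕ) * h) ω) ∂(P x) =
      ∑ p : Fin (n + 1) → S,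
        ((if p 0 = x then ∏ i : Fin n, NormedSpace.exp ((h : ℝ) • G) (p i.castSucc) (p i.succ)
          else 0 : ℝ) : ℂ) * Φ p := by
  have := hY.isProbabilityMeasure x
  have hm := hY.measurable_skeleton h n
  have : IsProbabilityMeasure
      ((P x).map fun ω => (fun i : Fin (n + 1) => Y ((i : ℕ) * h) ω)) :=
    Measure.isProbabilityMeasure_map hm.aemeasurable
  rw [← integral_map (φ := fun ω => (fun i : Fin (n + 1) => Y ((i : ℕ) * h) ω)) hm.aemeasurable
    (f := Φ) (measurable_of_finite Φ).aestronglyMeasurable, integral_fintype Integrable.of_finite]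
  refine Finset.sum_congr rfl fun p _ => ?_
  rw [map_measureReal_apply hm (measurableSet_singleton p), Complex.real_smul,
    ← hY.real_skeleton_eq h x n p]
  rfl

/-- The Markov property of the skeleton at its first step. -/
lemma IsCTMC.integral_skeleton_succ (hY : IsCTMC G P Y) (h : ℝ≥0) (x : S) (n : ℕ)
    (Φ : (Fin (n + 1 + 1) → S) → ℂ) :
    ∫ ω, Φ (fun i => Y ((i : ℕ) * h) ω) ∂(P x) =
      ∑ z : S, (NormedSpace.exp ((h : ℝ) • G) x z : ℂ) *
        ∫ ω, Φ (Fin.cons x fun i : Fin (n + 1) => Y ((i : ℕ) * h) ω) ∂(P z) := by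
  rw [hY.integral_skeleton]
  have h1 : ∀ z : S, ∫ ω, Φ (Fin.cons x fun i : Fin (n + 1) => Y ((i : ℕ) * h) ω) ∂(P z) = _ :=
    fun z => hY.integral_skeleton h z n fun q => Φ (Fin.cons x q)
  simp only [h1, Finset.mul_sum]
  -- Write a path as its first point followed by a tail q. Only the first point x carries mass, and
  -- on the other side only z = q 0 does.
  rw [Finset.sum_comm, ← (Fin.consEquiv fun _ : Fin (n + 1 + 1) => S).sum_comp,
    Fintype.sum_prod_type, Fintype.sum_eq_single x]
  · refine Finset.sum_congr rfl fun q _ => ?_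
    rw [Fintype.sum_eq_single (q 0)]
    · simp [Fin.consEquiv, Fin.prod_univ_succ (n := n), mul_assoc]
    · intro z hz
      simp [hz.symm]
  · intro w hw
    simp [Fin.consEquiv, hw]

end Skeleton

end DrawdownCTMC

namespace DrawdownCTMC

/-! ### Grid points and Riemann sums. -/

section Grid

/-- Rounding up makes grid points approach s from the right, the only side on which the path is
known to be locally constant with its value at s. This is also why the discount sums use right
endpoints. -/
lemma tendsto_natCeil_div_mul (s : ℝ≥0) :
    Filter.Tendsto (fun h : ℝ≥0 => (⌈s / h⌉₊ : ℝ≥0) * h) (𝓝[>] 0) (𝓝[≥] s) := by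
  have hle : ∀ᶠ h : ℝ≥0 in 𝓝[>] 0, s ≤ (⌈s / h⌉₊ : ℝ≥0) * h := by
    filter_upwards [self_mem_nhdsWithin] with h hh
    exact (div_le_iff₀ hh).1 (Nat.le_ceil _)
  have hge : ∀ᶠ h : ℝ≥0 in 𝓝[>] 0, (⌈s / h⌉₊ : ℝ≥0) * h ≤ s + h := by
    filter_upwards [self_mem_nhdsWithin] with h hh
    have hh' : 0 < h := hh
    calc (⌈s / h⌉₊ : ℝ≥0) * h ≤ (s / h + 1) * h := by
          gcongr
          exact (Nat.ceil_lt_add_one (zero_le)).le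
      _ = s + h := by rw [add_mul, div_mul_cancel₀ _ hh'.ne', one_mul]
  refine tendsto_nhdsWithin_iff.2 ⟨?_, hle⟩
  refine tendsto_of_tendsto_of_tendsto_of_le_of_le' tendsto_const_nhds ?_ hle hge
  have : Filter.Tendsto (fun h : ℝ≥0 => s + h) (𝓝 0) (𝓝 (s + 0)) :=
    tendsto_const_nhds.add Filter.tendsto_id
  rw [add_zero] at this
  exact this.mono_left nhdsWithin_le_nhds

lemma measurable_grid (φ : ℕ → ℂ) (h : ℝ≥0) :
    Measurable fun s : ℝ => φ ⌈s.toNNReal / h⌉₊ :=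
  (measurable_from_top (f := φ)).comp
    (Nat.measurable_ceil.comp (measurable_real_toNNReal.div_const h))

lemma intervalIntegrable_grid {φ : ℕ → ℂ} {B : ℝ} (hφ : ∀ i, ‖φ i‖ ≤ B) (h : ℝ≥0) (a b : ℝ) :
    IntervalIntegrable (fun s : ℝ => φ ⌈s.toNNReal / h⌉₊) volume a b :=
  (intervalIntegrable_const (c := B)).mono_fun (measurable_grid φ h).aestronglyMeasurable
    (Filter.Eventually.of_forall fun _ => (hφ _).trans (le_abs_self B))

lemma integral_grid {φ : ℕ → ℂ} {B : ℝ} (hφ : ∀ i, ‖φ i‖ ≤ B) {h : ℝ≥0} (hh : 0 < h) (J : ℕ) :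
    ∫ s in (0 : ℝ)..(J * h), φ ⌈s.toNNReal / h⌉₊ = h * ∑ i ∈ Finset.range J, φ (i + 1) := by
  induction J with
  | zero => simp
  | succ J ih =>
    rw [← intervalIntegral.integral_add_adjacent_intervals
      (intervalIntegrable_grid hφ h 0 (J * h)) (intervalIntegrable_grid hφ h _ _), ih,
      Finset.sum_range_succ, mul_add]
    congr 1
    have hle : (J * h : ℝ) ≤ ((J + 1 : ℕ) : ℝ) * h := by
      push_cast
      nlinarith [h.coe_nonneg]
    have : ∫ s in (J * h : ℝ)..((J + 1 : ℕ) : ℝ) * h, φ ⌈s.toNNReal / h⌉₊ =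
        ∫ s in (J * h : ℝ)..((J + 1 : ℕ) : ℝ) * h, φ (J + 1) := by
      refine intervalIntegral.integral_congr_ae (Filter.Eventually.of_forall fun s hs => ?_)
      rw [uIoc_of_le hle] at hs
      have h0 : 0 ≤ s := le_trans (by positivity) hs.1.le
      have hs' : (s.toNNReal : ℝ) = s := Real.coe_toNNReal s h0
      have : ⌈s.toNNReal / h⌉₊ = J + 1 := by
        rw [Nat.ceil_eq_iff (by omega)]
        constructor
        · rw [lt_div_iff₀ hh, ← NNReal.coe_lt_coe]
          simpa [hs'] using hs.1
        · rw [div_le_iff₀ hh, ← NNReal.coe_le_coe]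
          simpa [hs'] using hs.2
      simp only [this]
    rw [this, intervalIntegral.integral_const, Complex.real_smul]
    push_cast
    ring

end Grid

/-! ### Pathwise convergence of skeleton payoffs. -/

section Paths

variable {S : Finset ℝ} {Ω : Type*} {Y : ℝ≥0 → Ω → S} {y : S} {ω : Ω}

lemma le_runMax_start (Y : ℝ≥0 → Ω → S) (y : S) (t : ℝ≥0) (ω : Ω) : y ≤ runMax Y y t ω :=
  Finset.le_max' _ _ (Finset.mem_insert_self _ _)

open Classical in
lemma le_runMax (Y : ℝ≥0 → Ω → S) (y : S) {u t : ℝ≥0} (hu : u ≤ t) (ω : Ω) :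
    Y u ω ≤ runMax Y y t ω :=
  Finset.le_max' _ _ (Finset.mem_insert_of_mem (Finset.mem_filter.2 ⟨Finset.mem_univ _, u, hu, rfl⟩))

open Classical in
lemma runMax_le {b : S} {t : ℝ≥0} (hy : y ≤ b) (hb : ∀ u ≤ t, Y u ω ≤ b) :
    runMax Y y t ω ≤ b := by
  refine Finset.max'_le _ _ _ fun z hz => ?_
  rcases Finset.mem_insert.1 hz with rfl | hz
  · exact hy
  · obtain ⟨u, hu, rfl⟩ := (Finset.mem_filter.1 hz).2
    exact hb u hu

open Classical in
lemma runMax_eq_or (Y : ℝ≥0 → Ω → S) (y : S) (t : ℝ≥0) (ω : Ω) :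
    runMax Y y t ω = y ∨ ∃ u ≤ t, Y u ω = runMax Y y t ω := by
  rcases Finset.mem_insert.1 (Finset.max'_mem _ (Finset.insert_nonempty y
    (Finset.univ.filter fun z : S => ∃ u ≤ t, Y u ω = z))) with h | h
  · exact Or.inl (by unfold runMax; convert h)
  · refine Or.inr ?_
    obtain ⟨u, hu, h⟩ := (Finset.mem_filter.1 h).2
    exact ⟨u, hu, by rw [h]; unfold runMax; congr!⟩

lemma runMax_mono {s t : ℝ≥0} (hst : s ≤ t) : runMax Y y s ω ≤ runMax Y y t ω :=
  runMax_le (le_runMax_start _ _ _ _) fun _ hu => le_runMax _ _ (hu.trans hst) _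

lemma runMax_zero (h0 : Y 0 ω ≤ y) : runMax Y y 0 ω = y :=
  le_antisymm (runMax_le le_rfl fun u hu => by rwa [nonpos_iff_eq_zero.1 hu])
    (le_runMax_start _ _ _ _)

/-- The path of `ω` is right-continuous (for the discrete topology of the state space). -/
def RightConst (Y : ℝ≥0 → Ω → S) (ω : Ω) : Prop :=
  ∀ t, ∀ᶠ s in 𝓝[≥] t, Y s ω = Y t ω

lemma IsCTMC.rightConst [MeasurableSpace Ω] {G : Matrix S S ℝ} {P : S → Measure Ω}
    (hY : IsCTMC G P Y) (ω : Ω) : RightConst Y ω := fun t => by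
  have h := hY.rightContinuous ω t
  rw [ContinuousWithinAt, nhds_discrete, Filter.tendsto_pure] at h
  exact h

lemma exists_Ico_of_eventually {p : ℝ≥0 → Prop} {t : ℝ≥0} (h : ∀ᶠ s in 𝓝[≥] t, p s) :
    ∃ u, t < u ∧ ∀ s ∈ Ico t u, p s :=
  (mem_nhdsGE_iff_exists_Ico_subset).1 h

lemma RightConst.runMax (hrc : RightConst Y ω) (y : S) (t : ℝ≥0) :
    ∀ᶠ s in 𝓝[≥] t, runMax Y y s ω = runMax Y y t ω := by
  obtain ⟨u, htu, hu⟩ := exists_Ico_of_eventually (hrc t)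
  filter_upwards [Ico_mem_nhdsGE htu] with s hs
  refine le_antisymm (runMax_le (le_runMax_start _ _ _ _) fun v hv => ?_) (runMax_mono hs.1)
  rcases le_total v t with hvt | hvt
  · exact le_runMax _ _ hvt _
  · rw [hu v ⟨hvt, hv.trans_lt hs.2⟩]
    exact le_runMax _ _ le_rfl _

/-- The maximum is attained at some u ≤ s (or is y), and its value persists just after u, so a fine
grid sees it. Conversely, the grid overshoots s only within an interval on which the maximum is
unchanged. -/
lemma RightConst.seqMax_grid (hrc : RightConst Y ω) (h0 : Y 0 ω ≤ y) (s : ℝ≥0) :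
    ∀ᶠ h : ℝ≥0 in 𝓝[>] 0,
      seqMax y (fun j => Y (j * h) ω) ⌈s / h⌉₊ = DrawdownCTMC.runMax Y y s ω := by
  have hge : ∀ᶠ h : ℝ≥0 in 𝓝[>] 0,
      DrawdownCTMC.runMax Y y s ω ≤ seqMax y (fun j => Y (j * h) ω) ⌈s / h⌉₊ := by
    rcases runMax_eq_or Y y s ω with h | ⟨u, hu, h⟩
    · rw [h]
      exact Filter.Eventually.of_forall fun _ => le_seqMax_start _ _ _
    · filter_upwards [(tendsto_natCeil_div_mul u).eventually (hrc u)] with δ hδ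
      rw [← h, ← hδ]
      exact le_seqMax (z := fun j => Y (j * δ) ω) (by simpa using h0) (by gcongr)
  filter_upwards [hge, (tendsto_natCeil_div_mul s).eventually (hrc.runMax y s)] with h hh h2
  refine le_antisymm ?_ hh
  rw [← h2]
  exact seqMax_le (le_runMax_start _ _ _ _) fun i hi => le_runMax _ _ (by gcongr) _

lemma seqMax_grid_le (Y : ℝ≥0 → Ω → S) (y : S) (ω : Ω) (h : ℝ≥0) (j : ℕ) :
    seqMax y (fun j => Y (j * h) ω) j ≤ runMax Y y (j * h) ω :=
  seqMax_le (le_runMax_start _ _ _ _) fun i hi => le_runMax _ _ (by gcongr) _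

/-- The running discount rate along the path of `ω`. -/
noncomputable def rate (Y : ℝ≥0 → Ω → S) (y : S) (k : S → S → ℂ) (ω : Ω) (s : ℝ) : ℂ :=
  k (Y s.toNNReal ω) (runMax Y y s.toNNReal ω)

/-- The discount rate along the skeleton with mesh `h`. -/
noncomputable def gridRate (Y : ℝ≥0 → Ω → S) (y : S) (k : S → S → ℂ) (ω : Ω) (h : ℝ≥0)
    (j : ℕ) : ℂ :=
  k (Y (j * h) ω) (seqMax y (fun j => Y (j * h) ω) j)

lemma exists_norm_rate_le {ι : Type*} [Finite ι] (k : ι → ι → ℂ) : ∃ B, ∀ x y, ‖k x y‖ ≤ B := by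
  obtain ⟨B, hB⟩ := (Set.finite_range fun p : ι × ι => ‖k p.1 p.2‖).bddAbove
  exact ⟨B, fun x y => hB ⟨(x, y), rfl⟩⟩

lemma RightConst.tendsto_gridRate (hrc : RightConst Y ω) (h0 : Y 0 ω ≤ y) (k : S → S → ℂ)
    (s : ℝ) :
    Filter.Tendsto (fun h : ℝ≥0 => gridRate Y y k ω h ⌈s.toNNReal / h⌉₊) (𝓝[>] 0)
      (𝓝 (rate Y y k ω s)) := by
  refine tendsto_const_nhds.congr' ?_
  filter_upwards [hrc.seqMax_grid h0 s.toNNReal,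
    (tendsto_natCeil_div_mul s.toNNReal).eventually (hrc s.toNNReal)] with h h1 h2
  rw [gridRate, h1, h2, rate]

lemma RightConst.aestronglyMeasurable_rate (hrc : RightConst Y ω) (h0 : Y 0 ω ≤ y)
    (k : S → S → ℂ) (μ : Measure ℝ) : AEStronglyMeasurable (rate Y y k ω) μ :=
  aestronglyMeasurable_of_tendsto_ae (𝓝[>] (0 : ℝ≥0))
    (fun h => (measurable_grid (gridRate Y y k ω h) h).aestronglyMeasurable)
    (Filter.Eventually.of_forall fun s => hrc.tendsto_gridRate h0 k s)

lemma RightConst.intervalIntegrable_rate (hrc : RightConst Y ω) (h0 : Y 0 ω ≤ y)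
    (k : S → S → ℂ) (a b : ℝ) : IntervalIntegrable (rate Y y k ω) volume a b := by
  obtain ⟨B, hB⟩ := exists_norm_rate_le k
  exact (intervalIntegrable_const (c := B)).mono_fun (hrc.aestronglyMeasurable_rate h0 k _)
    (Filter.Eventually.of_forall fun _ => (hB _ _).trans (le_abs_self B))

lemma RightConst.tendsto_integral_gridRate (hrc : RightConst Y ω) (h0 : Y 0 ω ≤ y)
    (k : S → S → ℂ) (T : ℝ≥0) :
    Filter.Tendsto (fun h : ℝ≥0 => ∫ s in (0 : ℝ)..((⌈T / h⌉₊ : ℝ) * h),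
      gridRate Y y k ω h ⌈s.toNNReal / h⌉₊) (𝓝[>] 0)
      (𝓝 (∫ s in (0 : ℝ)..T, rate Y y k ω s)) := by
  obtain ⟨B, hB⟩ := exists_norm_rate_le k
  have hB' : ∀ h j, ‖gridRate Y y k ω h j‖ ≤ B := fun h j => hB _ _
  have hA : Filter.Tendsto (fun h : ℝ≥0 => ∫ s in (0 : ℝ)..T,
      gridRate Y y k ω h ⌈s.toNNReal / h⌉₊) (𝓝[>] 0) (𝓝 (∫ s in (0 : ℝ)..T, rate Y y k ω s)) :=
    intervalIntegral.tendsto_integral_filter_of_dominated_convergence (fun _ => B)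
      (Filter.Eventually.of_forall fun h => (measurable_grid _ h).aestronglyMeasurable)
      (Filter.Eventually.of_forall fun h => Filter.Eventually.of_forall fun s _ => hB' _ _)
      intervalIntegrable_const
      (Filter.Eventually.of_forall fun s _ => hrc.tendsto_gridRate h0 k s)
  -- The overshoot past T has vanishing length and a bounded integrand.
  have hC : Filter.Tendsto (fun h : ℝ≥0 => ∫ s in (T : ℝ)..((⌈T / h⌉₊ : ℝ) * h),
      gridRate Y y k ω h ⌈s.toNNReal / h⌉₊) (𝓝[>] 0) (𝓝 0) := by
    have h1 : Filter.Tendsto (fun h : ℝ≥0 => ((⌈T / h⌉₊ : ℝ≥0) * h : ℝ≥0)) (𝓝[>] 0) (𝓝 T) :=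
      (tendsto_natCeil_div_mul T).mono_right nhdsWithin_le_nhds
    have h2 : Filter.Tendsto (fun h : ℝ≥0 => B * |(⌈T / h⌉₊ : ℝ) * h - T|) (𝓝[>] 0) (𝓝 0) := by
      have := ((NNReal.tendsto_coe.2 h1).sub_const (T : ℝ)).abs.const_mul B
      simpa using this
    refine squeeze_zero_norm (fun h => ?_) h2
    exact intervalIntegral.norm_integral_le_of_norm_le_const fun s _ => hB' _ _
  have := hA.add hC
  rw [add_zero] at this
  refine this.congr fun h => ?_
  exact intervalIntegral.integral_add_adjacent_intervals
    (intervalIntegrable_grid (hB' h) h _ _) (intervalIntegrable_grid (hB' h) h _ _)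

/-- The first time at which `(Y, Ȳ)` is outside of `D`. -/
noncomputable def exitTime (Y : ℝ≥0 → Ω → S) (y : S) (D : S → S → Prop) (ω : Ω) : ℝ≥0∞ :=
  sInf ((fun t : ℝ≥0 => (t : ℝ≥0∞)) '' {t | ¬ D (Y t ω) (runMax Y y t ω)})

open Classical in
/-- The discounted payoff at the first exit of `(Y, Ȳ)` from `D`. -/
noncomputable def exitVar (Y : ℝ≥0 → Ω → S) (y : S) (D : S → S → Prop) (k : S → S → ℂ)
    (g : S → ℝ) (ω : Ω) : ℂ :=
  if exitTime Y y D ω < ∞ then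
    Complex.exp (-∫ s in (0 : ℝ)..(exitTime Y y D ω).toReal, rate Y y k ω s) *
      (g (Y (exitTime Y y D ω).toNNReal ω) : ℂ)
  else 0

lemma sInf_coe_image_eq {E : Set ℝ≥0} {T : ℝ≥0} (hT : ∀ u, T < u → ∃ t ∈ E, t < u)
    (hlt : ∀ t < T, t ∉ E) : sInf ((fun t : ℝ≥0 => (t : ℝ≥0∞)) '' E) = T := by
  refine le_antisymm (le_of_forall_gt fun c hc => ?_) (le_sInf ?_)
  · rw [sInf_lt_iff]
    obtain ⟨u, hTu, huc⟩ := ENNReal.lt_iff_exists_nnreal_btwn.1 hc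
    obtain ⟨t, ht, htu⟩ := hT u (by exact_mod_cast hTu)
    exact ⟨t, ⟨t, ht, rfl⟩, lt_trans (by exact_mod_cast htu) huc⟩
  · rintro _ ⟨t, ht, rfl⟩
    by_contra hcon
    exact hlt t (by simpa using hcon) ht

lemma sInf_coe_image_empty : sInf ((fun t : ℝ≥0 => (t : ℝ≥0∞)) '' ∅) = ∞ := by simp

/-- A set of times that is closed from the right has a first element. -/
lemma exists_first {E : Set ℝ≥0} (hE : ∀ t ∉ E, ∀ᶠ s in 𝓝[≥] t, s ∉ E) (hne : E.Nonempty) :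
    ∃ T ∈ E, ∀ t < T, t ∉ E := by
  refine ⟨sInf E, ?_, fun t ht => notMem_of_lt_csInf ht (OrderBot.bddBelow E)⟩
  by_contra hcon
  obtain ⟨u, hu, hlt⟩ := exists_Ico_of_eventually (hE _ hcon)
  refine absurd (le_csInf hne fun t ht => ?_) (not_le.2 hu)
  by_contra htu
  exact hlt t ⟨csInf_le (OrderBot.bddBelow E) ht, not_le.1 htu⟩ ht

lemma exitTime_eq {D : S → S → Prop} {T : ℝ≥0} (hT : ¬ D (Y T ω) (runMax Y y T ω))
    (hlt : ∀ t < T, D (Y t ω) (runMax Y y t ω)) : exitTime Y y D ω = T :=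
  sInf_coe_image_eq (fun _ hu => ⟨T, hT, hu⟩) fun t ht => not_not.2 (hlt t ht)

lemma exitTime_eq_top {D : S → S → Prop} (hD : ∀ t, D (Y t ω) (runMax Y y t ω)) :
    exitTime Y y D ω = ∞ := by
  have : {t | ¬ D (Y t ω) (runMax Y y t ω)} = ∅ := by
    ext t
    simp [hD]
  rw [exitTime, this, sInf_coe_image_empty]

lemma exitVar_eq {D : S → S → Prop} {T : ℝ≥0} (hT : ¬ D (Y T ω) (runMax Y y T ω))
    (hlt : ∀ t < T, D (Y t ω) (runMax Y y t ω)) (k : S → S → ℂ) (g : S → ℝ) :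
    exitVar Y y D k g ω =
      Complex.exp (-∫ s in (0 : ℝ)..T, rate Y y k ω s) * (g (Y T ω) : ℂ) := by
  rw [exitVar, exitTime_eq hT hlt, if_pos ENNReal.coe_lt_top, ENNReal.coe_toReal,
    ENNReal.toNNReal_coe]

lemma exitVar_eq_zero {D : S → S → Prop} (hD : ∀ t, D (Y t ω) (runMax Y y t ω))
    (k : S → S → ℂ) (g : S → ℝ) : exitVar Y y D k g ω = 0 := by
  rw [exitVar, exitTime_eq_top hD, if_neg (lt_irrefl _)]

lemma RightConst.exists_exit_or (hrc : RightConst Y ω) (y : S) (D : S → S → Prop) :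
    (∀ t, D (Y t ω) (DrawdownCTMC.runMax Y y t ω)) ∨
      ∃ T, ¬ D (Y T ω) (DrawdownCTMC.runMax Y y T ω) ∧
        ∀ t < T, D (Y t ω) (DrawdownCTMC.runMax Y y t ω) := by
  by_cases h : ∀ t, D (Y t ω) (DrawdownCTMC.runMax Y y t ω)
  · exact Or.inl h
  · push Not at h
    obtain ⟨T, hT, hlt⟩ := exists_first
      (E := {t | ¬ D (Y t ω) (DrawdownCTMC.runMax Y y t ω)}) (fun t ht => by
        filter_upwards [hrc t, hrc.runMax y t] with s h1 h2
        simpa only [mem_ofPred_eq, h1, h2] using ht) h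
    exact Or.inr ⟨T, hT, fun t ht => not_not.1 (hlt t ht)⟩

/-- Convergence of the skeleton functionals to the functional of the path. -/
lemma RightConst.tendsto_seqExitVar (hrc : RightConst Y ω) (h0 : Y 0 ω ≤ y) {D : S → S → Prop}
    (hD : ∀ x m m', m ≤ m' → D x m' → D x m) (k : S → S → ℂ) (g : S → ℝ) :
    Filter.Tendsto (fun h : ℝ≥0 => seqExitVar (h : ℝ) D k g y (fun j => Y (j * h) ω)) (𝓝[>] 0)
      (𝓝 (exitVar Y y D k g ω)) := by
  rcases hrc.exists_exit_or y D with hin | ⟨T, hT, hlt⟩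
  · rw [exitVar_eq_zero hin]
    refine tendsto_const_nhds.congr fun h => ?_
    rw [seqExitVar_eq_zero]
    -- The skeleton maximum never exceeds the true one, so by monotonicity of `D` the skeleton stays
    -- inside whenever the path does.
    exact fun i => hD _ _ _ (seqMax_grid_le Y y ω h i) (hin _)
  · rw [exitVar_eq hT hlt]
    have hlim := ((hrc.tendsto_integral_gridRate h0 k T).neg.cexp).mul_const (g (Y T ω) : ℂ)
    refine hlim.congr' ?_
    obtain ⟨B, hB⟩ := exists_norm_rate_le k
    filter_upwards [self_mem_nhdsWithin, hrc.seqMax_grid h0 T,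
      (tendsto_natCeil_div_mul T).eventually (hrc T)] with h hh h1 h2
    have hh' : 0 < h := hh
    -- The skeleton exits at the first grid point at or after T: earlier ones are still inside, and
    -- for small h this one sees the state and maximum of time T.
    rw [seqExitVar_eq (J := ⌈T / h⌉₊), h2,
      integral_grid (φ := gridRate Y y k ω h) (fun j => hB _ _) hh']
    · rfl
    · intro i hi
      refine hD _ _ _ (seqMax_grid_le Y y ω h i) (hlt _ ?_)
      rw [Nat.lt_ceil, lt_div_iff₀ hh'] at hi
      exact hi
    · rw [h1, h2]
      exact hT

lemma norm_exitVar_le (hrc : RightConst Y ω) (h0 : Y 0 ω ≤ y) {D : S → S → Prop}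
    (hD : ∀ x m m', m ≤ m' → D x m' → D x m) {k : S → S → ℂ} (hk : ∀ x y, 0 ≤ (k x y).re)
    {g : S → ℝ} {B : ℝ} (hB : 0 ≤ B) (hg : ∀ x, |g x| ≤ B) : ‖exitVar Y y D k g ω‖ ≤ B :=
  le_of_tendsto (hrc.tendsto_seqExitVar h0 hD k g).norm
    (Filter.Eventually.of_forall fun h => norm_seqExitVar_le h.coe_nonneg hk hB hg _ _)

end Paths

end DrawdownCTMC

namespace DrawdownCTMC

/-! ### From the skeleton recursion to the generator equation. -/

section Generator

open scoped Matrix.Norms.Operator in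
lemma hasDerivAt_exp_smul_apply {n : Type*} [Fintype n] [DecidableEq n] (G : Matrix n n ℝ)
    (x z : n) :
    HasDerivAt (fun t : ℝ => NormedSpace.exp (t • G) x z) (G x z) 0 := by
  have h := hasDerivAt_exp_smul_const (𝕂 := ℝ) G (0 : ℝ)
  rw [zero_smul, NormedSpace.exp_zero, one_mul] at h
  exact hasDerivAt_pi.1 (hasDerivAt_pi.1 h x) z

lemma hasDerivAt_exp_smul_apply_mul_cexp {n : Type*} [Fintype n] [DecidableEq n]
    (G : Matrix n n ℝ) (x z : n) (c : ℂ) :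
    HasDerivAt (fun t : ℝ => (NormedSpace.exp (t • G) x z : ℂ) * Complex.exp (-(t * c)))
      (G x z - (1 : Matrix n n ℂ) x z * c) 0 := by
  have h1 := (hasDerivAt_exp_smul_apply G x z).ofReal_comp
  have h2 : HasDerivAt (fun t : ℝ => Complex.exp (-(t * c))) (-c) 0 := by
    have := ((Complex.ofRealCLM.hasDerivAt (x := 0)).mul_const c).neg.cexp
    simpa using this
  refine (h1.mul h2).congr_deriv ?_
  rcases eq_or_ne x z with rfl | hxz
  · simp [sub_eq_add_neg]
  · simp [hxz]

variable {S : Finset ℝ} {Ω : Type*} [MeasurableSpace Ω] {G : Matrix S S ℝ}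
  {P : S → Measure Ω} {Y : ℝ≥0 → Ω → S} {D : S → S → Prop} {k : S → S → ℂ} {g : S → ℝ}

lemma exists_abs_le {ι : Type*} [Finite ι] (g : ι → ℝ) : ∃ B, 0 ≤ B ∧ ∀ x, |g x| ≤ B := by
  obtain ⟨B, hB⟩ := (Set.finite_range fun x => |g x|).bddAbove
  exact ⟨max B 0, le_max_right _ _, fun x => (hB ⟨x, rfl⟩).trans (le_max_left _ _)⟩

lemma IsCTMC.aestronglyMeasurable_truncExitVar (hY : IsCTMC G P Y) (h : ℝ≥0) (N : ℕ) (x y : S) :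
    AEStronglyMeasurable
      (fun ω => truncExitVar (h : ℝ) D k g N y (fun i => Y ((i : ℕ) * h) ω)) (P x) :=
  ((measurable_of_finite (truncExitVar (h : ℝ) D k g N y)).comp
    (hY.measurable_skeleton h N)).aestronglyMeasurable

lemma IsCTMC.aestronglyMeasurable_seqExitVar (hY : IsCTMC G P Y) (h : ℝ≥0) (x y : S) :
    AEStronglyMeasurable
      (fun ω => seqExitVar (h : ℝ) D k g y (fun j => Y (j * h) ω)) (P x) :=
  aestronglyMeasurable_of_tendsto_ae Filter.atTop
    (fun N => hY.aestronglyMeasurable_truncExitVar h N x y)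
    (Filter.Eventually.of_forall fun ω => tendsto_truncExitVar y fun j => Y (j * h) ω)

lemma IsCTMC.tendsto_integral_truncExitVar (hY : IsCTMC G P Y) (hk : ∀ x y, 0 ≤ (k x y).re)
    (h : ℝ≥0) (x y : S) :
    Filter.Tendsto
      (fun N => ∫ ω, truncExitVar (h : ℝ) D k g N y (fun i => Y ((i : ℕ) * h) ω) ∂(P x))
      Filter.atTop (𝓝 (∫ ω, seqExitVar (h : ℝ) D k g y (fun j => Y (j * h) ω) ∂(P x))) := by
  have := hY.isProbabilityMeasure x
  obtain ⟨B, hB0, hB⟩ := exists_abs_le g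
  exact tendsto_integral_of_dominated_convergence (fun _ => B)
    (fun N => hY.aestronglyMeasurable_truncExitVar h N x y) (integrable_const B)
    (fun N => Filter.Eventually.of_forall fun ω =>
      norm_truncExitVar_le h.coe_nonneg hk hB0 hB _ _ _)
    (Filter.Eventually.of_forall fun ω => tendsto_truncExitVar y fun j => Y (j * h) ω)

lemma IsCTMC.integral_truncExitVar_succ (hY : IsCTMC G P Y) (h : ℝ≥0) (N : ℕ) {x y : S}
    (hD : D x y) :
    ∫ ω, truncExitVar (h : ℝ) D k g (N + 1) y (fun i => Y ((i : ℕ) * h) ω) ∂(P x) =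
      ∑ z : S, ((NormedSpace.exp ((h : ℝ) • G) x z : ℂ) * Complex.exp (-((h : ℝ) * k z (y ⊔ z)))) *
        ∫ ω, truncExitVar (h : ℝ) D k g N (y ⊔ z) (fun i => Y ((i : ℕ) * h) ω) ∂(P z) := by
  rw [hY.integral_skeleton_succ h x N (truncExitVar (h : ℝ) D k g (N + 1) y)]
  refine Finset.sum_congr rfl fun z _ => ?_
  rw [mul_assoc]
  refine congrArg _ ?_
  rw [← integral_const_mul]
  refine integral_congr_ae ?_
  filter_upwards [hY.ae_zero z] with ω hω
  rw [truncExitVar, if_pos (by simpa using hD), Fin.tail_cons]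
  simp [hω]

/-- The Markov property is available only for finitely many steps, so the recursion is proved for
truncated payoffs and N → ∞ is taken on both sides. -/
lemma IsCTMC.integral_seqExitVar_eq (hY : IsCTMC G P Y) (hk : ∀ x y, 0 ≤ (k x y).re)
    (h : ℝ≥0) {x y : S} (hD : D x y) :
    ∫ ω, seqExitVar (h : ℝ) D k g y (fun j => Y (j * h) ω) ∂(P x) =
      ∑ z : S, ((NormedSpace.exp ((h : ℝ) • G) x z : ℂ) * Complex.exp (-((h : ℝ) * k z (y ⊔ z)))) *
        ∫ ω, seqExitVar (h : ℝ) D k g (y ⊔ z) (fun j => Y (j * h) ω) ∂(P z) := by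
  refine tendsto_nhds_unique ((Filter.tendsto_add_atTop_iff_nat 1).2
    (hY.tendsto_integral_truncExitVar hk h x y)) ?_
  simp only [hY.integral_truncExitVar_succ h _ hD]
  exact tendsto_finsetSum _ fun z _ => (hY.tendsto_integral_truncExitVar hk h z _).const_mul _

lemma IsCTMC.ae_zero_le (hY : IsCTMC G P Y) {x y : S} (hxy : x ≤ y) :
    ∀ᵐ ω ∂(P x), Y 0 ω ≤ y := by
  filter_upwards [hY.ae_zero x] with ω hω
  rwa [hω]

lemma IsCTMC.aestronglyMeasurable_exitVar (hY : IsCTMC G P Y)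
    (hD : ∀ x m m', m ≤ m' → D x m' → D x m) {x y : S} (hxy : x ≤ y) :
    AEStronglyMeasurable (exitVar Y y D k g) (P x) := by
  refine aestronglyMeasurable_of_tendsto_ae (𝓝[>] (0 : ℝ≥0))
    (fun h => hY.aestronglyMeasurable_seqExitVar (D := D) (k := k) (g := g) h x y) ?_
  filter_upwards [hY.ae_zero_le hxy] with ω hω
  exact (hY.rightConst ω).tendsto_seqExitVar hω hD k g

lemma IsCTMC.integrable_exitVar (hY : IsCTMC G P Y)
    (hD : ∀ x m m', m ≤ m' → D x m' → D x m) (hk : ∀ x y, 0 ≤ (k x y).re) {x y : S}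
    (hxy : x ≤ y) : Integrable (exitVar Y y D k g) (P x) := by
  have := hY.isProbabilityMeasure x
  obtain ⟨B, hB0, hB⟩ := exists_abs_le g
  refine (integrable_const B).mono' (hY.aestronglyMeasurable_exitVar hD hxy) ?_
  filter_upwards [hY.ae_zero_le hxy] with ω hω
  exact norm_exitVar_le (hY.rightConst ω) hω hD hk hB0 hB

/-- The expected discounted payoff at the first exit of `(Y, Ȳ)` from `D`. -/
noncomputable def exitMean (P : S → Measure Ω) (Y : ℝ≥0 → Ω → S) (D : S → S → Prop)
    (k : S → S → ℂ) (g : S → ℝ) (x y : S) : ℂ :=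
  ∫ ω, exitVar Y y D k g ω ∂(P x)

lemma IsCTMC.tendsto_integral_seqExitVar (hY : IsCTMC G P Y)
    (hD : ∀ x m m', m ≤ m' → D x m' → D x m) (hk : ∀ x y, 0 ≤ (k x y).re) {x y : S}
    (hxy : x ≤ y) :
    Filter.Tendsto
      (fun h : ℝ≥0 => ∫ ω, seqExitVar (h : ℝ) D k g y (fun j => Y (j * h) ω) ∂(P x))
      (𝓝[>] 0) (𝓝 (exitMean P Y D k g x y)) := by
  have := hY.isProbabilityMeasure x
  obtain ⟨B, hB0, hB⟩ := exists_abs_le g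
  refine tendsto_integral_filter_of_dominated_convergence (fun _ => B)
    (Filter.Eventually.of_forall fun h => hY.aestronglyMeasurable_seqExitVar h x y)
    (Filter.Eventually.of_forall fun h => Filter.Eventually.of_forall fun ω =>
      norm_seqExitVar_le h.coe_nonneg hk hB0 hB _ _) (integrable_const B) ?_
  filter_upwards [hY.ae_zero_le hxy] with ω hω
  exact (hY.rightConst ω).tendsto_seqExitVar hω hD k g

lemma tendsto_coe_nhdsGT_zero :
    Filter.Tendsto (fun h : ℝ≥0 => (h : ℝ)) (𝓝[>] 0) (𝓝[>] 0) := by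
  refine tendsto_nhdsWithin_iff.2 ⟨?_, ?_⟩
  · exact (NNReal.continuous_coe.tendsto' 0 0 rfl).mono_left nhdsWithin_le_nhds
  · filter_upwards [self_mem_nhdsWithin] with h hh
    exact NNReal.coe_pos.2 hh

/-- Inside `D`, the expected discounted payoff solves the generator equation. -/
theorem IsCTMC.exitMean_generator (hY : IsCTMC G P Y)
    (hD : ∀ x m m', m ≤ m' → D x m' → D x m) (hk : ∀ x y, 0 ≤ (k x y).re) {x y : S}
    (hxy : x ≤ y) (hin : D x y) :
    k x y * exitMean P Y D k g x y = ∑ z : S, (G x z : ℂ) * exitMean P Y D k g z (y ⊔ z) := by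
  set u : ℝ≥0 → S → S → ℂ := fun h x y =>
    ∫ ω, seqExitVar (h : ℝ) D k g y (fun j => Y (j * h) ω) ∂(P x)
  set φ : S → ℝ → ℂ := fun z t =>
    (NormedSpace.exp (t • G) x z : ℂ) * Complex.exp (-(t * k z (y ⊔ z)))
  have hlim : Filter.Tendsto
      (fun h : ℝ≥0 => ∑ z : S, ((h : ℝ)⁻¹ • (φ z (0 + h) - φ z 0)) * u h z (y ⊔ z)) (𝓝[>] 0)
      (𝓝 (∑ z : S, (G x z - (1 : Matrix S S ℂ) x z * k z (y ⊔ z)) *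
        exitMean P Y D k g z (y ⊔ z))) :=
    tendsto_finsetSum _ fun z _ =>
      ((hasDerivAt_exp_smul_apply_mul_cexp G x z _).tendsto_slope_zero_right.comp
        tendsto_coe_nhdsGT_zero).mul (hY.tendsto_integral_seqExitVar hD hk le_sup_right)
  have hzero : ∀ h : ℝ≥0,
      ∑ z : S, ((h : ℝ)⁻¹ • (φ z (0 + h) - φ z 0)) * u h z (y ⊔ z) = 0 := by
    -- Both sums equal `u h x y`: at time h by the recursion, at time 0 because the kernel is the
    -- identity there. Hence the difference quotients sum to zero exactly, and no differentiability
    -- of u in h is needed.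
    intro h
    have h1 : ∑ z : S, φ z h * u h z (y ⊔ z) = u h x y :=
      (hY.integral_seqExitVar_eq hk h hin).symm
    have h2 : ∑ z : S, φ z 0 * u h z (y ⊔ z) = u h x y := by
      rw [Fintype.sum_eq_single x]
      · simp [φ, hxy]
      · intro z hz
        simp [φ, Matrix.one_apply_ne' hz]
    simp only [zero_add, smul_mul_assoc, sub_mul, ← Finset.smul_sum, Finset.sum_sub_distrib,
      h1, h2, sub_self, smul_zero]
  simp only [hzero] at hlim
  have := tendsto_nhds_unique hlim tendsto_const_nhds
  simp only [sub_mul, Finset.sum_sub_distrib, Matrix.one_apply, ite_mul, one_mul, zero_mul,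
    Finset.sum_ite_eq, Finset.mem_univ, if_true, sup_eq_left.2 hxy] at this
  exact (sub_eq_zero.1 this).symm

lemma IsCTMC.exitMean_boundary (hY : IsCTMC G P Y) {x y : S} (hxy : x ≤ y) (hout : ¬ D x y) :
    exitMean P Y D k g x y = g x := by
  have := hY.isProbabilityMeasure x
  have : exitVar Y y D k g =ᵐ[P x] fun _ => (g x : ℂ) := by
    filter_upwards [hY.ae_zero x] with ω hω
    rw [exitVar_eq (T := 0) (by rw [runMax_zero (hω.trans_le hxy), hω]; exact hout)
      (fun t ht => absurd ht not_lt_zero)]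
    simp [hω]
  rw [exitMean, integral_congr_ae this]
  simp

omit [MeasurableSpace Ω] in
lemma exitVar_add_const {y : S} {ω : Ω} (hrc : RightConst Y ω) (h0 : Y 0 ω ≤ y) (c : ℂ) :
    exitVar Y y D (fun x m => k x m + c) g ω =
      Complex.exp (-((exitTime Y y D ω).toReal * c)) * exitVar Y y D k g ω := by
  unfold exitVar
  split_ifs
  · have : ∀ T : ℝ, ∫ s in (0 : ℝ)..T, rate Y y (fun x m => k x m + c) ω s =
        (∫ s in (0 : ℝ)..T, rate Y y k ω s) + T * c := by
      intro T
      have := intervalIntegral.integral_add (hrc.intervalIntegrable_rate h0 k 0 T)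
        (intervalIntegrable_const (c := c))
      simpa [rate] using this
    rw [this, ← mul_assoc, ← Complex.exp_add]
    ring_nf
  · simp

/-- Adding δ to the rate multiplies the payoff by e^{-δT}, with T the exit time, which tends to 1;
paths that never exit contribute zero. -/
lemma IsCTMC.tendsto_exitMean_add_const (hY : IsCTMC G P Y)
    (hD : ∀ x m m', m ≤ m' → D x m' → D x m) (hk : ∀ x y, 0 ≤ (k x y).re) {x y : S}
    (hxy : x ≤ y) :
    Filter.Tendsto (fun δ : ℝ => exitMean P Y D (fun x m => k x m + δ) g x y) (𝓝[>] 0)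
      (𝓝 (exitMean P Y D k g x y)) := by
  have := hY.isProbabilityMeasure x
  obtain ⟨B, hB0, hB⟩ := exists_abs_le g
  refine tendsto_integral_filter_of_dominated_convergence (fun _ => B)
    (Filter.Eventually.of_forall fun δ => hY.aestronglyMeasurable_exitVar hD hxy) ?_
    (integrable_const B) ?_
  · filter_upwards [self_mem_nhdsWithin] with δ hδ
    filter_upwards [hY.ae_zero_le hxy] with ω hω
    refine norm_exitVar_le (hY.rightConst ω) hω hD (fun x m => ?_) hB0 hB
    simpa using add_nonneg (hk x m) (le_of_lt hδ)
  · filter_upwards [hY.ae_zero_le hxy] with ω hω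
    simp only [exitVar_add_const (hY.rightConst ω) hω]
    have hc : Continuous fun δ : ℝ =>
        Complex.exp (-((exitTime Y y D ω).toReal * (δ : ℂ))) * exitVar Y y D k g ω := by
      fun_prop
    exact (hc.tendsto' 0 _ (by simp)).mono_left nhdsWithin_le_nhds

end Generator

end DrawdownCTMC

namespace DrawdownCTMC

/-! ### The given functionals as exit payoffs. -/

section Passage

variable {S : Finset ℝ} {Ω : Type*} {Y : ℝ≥0 → Ω → S} {ω : Ω}

/-- The infimum runs over t > 0 only. If T = 0 it is still the infimum, since the path stays outside
`A` for a while after T. -/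
lemma RightConst.passageTime_eq (hrc : RightConst Y ω) {A : Set ℝ} {T : ℝ≥0}
    (hT : (Y T ω : ℝ) ∉ A) (hlt : ∀ t < T, (Y t ω : ℝ) ∈ A) : passageTime Y A ω = T := by
  refine sInf_coe_image_eq (fun u hu => ?_) fun t ht h => h.2 (hlt t ht)
  obtain ⟨v, hTv, hv⟩ := exists_Ico_of_eventually (hrc T)
  obtain ⟨t, hTt, ht⟩ := exists_between (lt_min hu hTv)
  refine ⟨t, ⟨pos_of_gt hTt, ?_⟩, ht.trans_le (min_le_left _ _)⟩
  rwa [hv t ⟨hTt.le, ht.trans_le (min_le_right _ _)⟩]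

lemma le_passageTime {A : Set ℝ} {T : ℝ≥0} (hlt : ∀ t < T, (Y t ω : ℝ) ∈ A) :
    (T : ℝ≥0∞) ≤ passageTime Y A ω := by
  refine le_sInf ?_
  rintro _ ⟨t, ht, rfl⟩
  by_contra hcon
  exact ht.2 (hlt t (by simpa using hcon))

lemma passageTime_eq_top {A : Set ℝ} (h : ∀ t, (Y t ω : ℝ) ∈ A) : passageTime Y A ω = ∞ := by
  have : {t | 0 < t ∧ (Y t ω : ℝ) ∉ A} = ∅ := by
    ext t
    simp [h]
  rw [passageTime, this, sInf_coe_image_empty]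

lemma RightConst.passageVar_eq (hrc : RightConst Y ω) (y : S) (A : Set ℝ) (κ : S → ℂ)
    (g : S → ℝ) :
    passageVar Y A κ g ω = exitVar Y y (fun x _ => (x : ℝ) ∈ A) (fun x _ => κ x) g ω := by
  have : passageTime Y A ω = exitTime Y y (fun x _ => (x : ℝ) ∈ A) ω := by
    rcases hrc.exists_exit_or y (fun x _ => (x : ℝ) ∈ A) with h | ⟨T, hT, hlt⟩
    · rw [passageTime_eq_top h, exitTime_eq_top h]
    · rw [hrc.passageTime_eq hT hlt, exitTime_eq hT hlt]
  unfold passageVar exitVar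
  rw [this]
  rfl

lemma drawdownVar_eq (Y : ℝ≥0 → Ω → S) (y : S) (a : ℝ) (k : S → S → ℂ) (f : S → ℝ) :
    drawdownVar Y y a k f = exitVar Y y (fun x m => (m : ℝ) - x < a) k f := by
  ext ω
  have : drawdownTime Y y a ω = exitTime Y y (fun x m => (m : ℝ) - x < a) ω := by
    simp only [drawdownTime, exitTime, not_lt]
  unfold drawdownVar exitVar
  rw [this]
  rfl

lemma RightConst.upcrossVar_eq (hrc : RightConst Y ω) (y : S) {l r : ℝ} (hlr : l < r)
    (k : S → S → ℂ) (g : S → ℝ) :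
    upcrossVar Y y l r k g ω =
      exitVar Y y (fun x _ => (x : ℝ) ∈ Ioc l r) k (fun x => if r < (x : ℝ) then g x else 0) ω := by
  rcases hrc.exists_exit_or y (fun x _ => (x : ℝ) ∈ Ioc l r) with h | ⟨T, hT, hlt⟩
  · rw [exitVar_eq_zero h, upcrossVar, upTime, passageTime_eq_top (A := Iic r) fun t => (h t).2,
      if_neg not_top_lt]
  · rw [exitVar_eq hT hlt]
    by_cases hr : r < Y T ω
    · have hup : upTime Y r ω = T :=
        hrc.passageTime_eq (by simpa using hr) fun t ht => (hlt t ht).2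
      obtain ⟨v, hTv, hv⟩ := exists_Ico_of_eventually (hrc T)
      -- The path keeps its value above r > l up to some v > T, which gives the strict inequality
      -- between the two passage times.
      have hdown : (v : ℝ≥0∞) ≤ downTime Y l ω := by
        refine le_passageTime fun t ht => ?_
        rcases lt_or_ge t T with htT | htT
        · exact (hlt t htT).1
        · rw [hv t ⟨htT, ht⟩]
          exact hlr.trans hr
      rw [upcrossVar, hup, if_pos (lt_of_lt_of_le (by exact_mod_cast hTv) hdown), if_pos hr,
        ENNReal.coe_toReal, ENNReal.toNNReal_coe]
      rfl
    · have hl : (Y T ω : ℝ) ≤ l := by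
        by_contra hl
        exact hT ⟨not_le.1 hl, not_lt.1 hr⟩
      have hdown : downTime Y l ω = T :=
        hrc.passageTime_eq (by simpa using hl) fun t ht => (hlt t ht).1
      have hup : (T : ℝ≥0∞) ≤ upTime Y r ω := le_passageTime fun t ht => (hlt t ht).2
      rw [upcrossVar, hdown, if_neg (not_lt.2 hup), if_neg hr]
      simp

end Passage

/-! ### Uniqueness and the decomposition of the drawdown functional. -/

section Decomposition

/-- The maximum principle for the killed generator with zero boundary values. -/
lemma IsRateMatrix.eq_zero_of_generator {S : Finset ℝ} {G : Matrix S S ℝ} (hG : IsRateMatrix G)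
    {A : S → Prop} {κ d : S → ℂ} (hκ : ∀ x, 0 < (κ x).re) (hout : ∀ x, ¬ A x → d x = 0)
    (hin : ∀ x, A x → κ x * d x = ∑ z : S, (G x z : ℂ) * d z) (x : S) : d x = 0 := by
  have : Nonempty S := ⟨x⟩
  obtain ⟨m, hm⟩ := Finite.exists_max fun x => ‖d x‖
  suffices hm0 : ‖d m‖ ≤ 0 from norm_le_zero_iff.1 ((hm x).trans hm0)
  by_cases hA : A m
  swap
  · rw [hout m hA, norm_zero]
  set q := ∑ z ∈ Finset.univ.erase m, G m z
  have hq : 0 ≤ q := Finset.sum_nonneg fun z hz =>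
    hG.offDiag_nonneg m z (Finset.ne_of_mem_erase hz).symm
  -- At a point m where ‖d‖ is maximal, move the diagonal term to the left. The right side then has
  -- norm at most q‖d m‖ and the left at least (Re κ + q)‖d m‖, so d m = 0.
  have h1 : (κ m + q) * d m = ∑ z ∈ Finset.univ.erase m, (G m z : ℂ) * d z := by
    have h2 := hin m hA
    rw [← Finset.add_sum_erase _ _ (Finset.mem_univ m), hG.diag_eq m] at h2
    rw [add_mul, h2]
    push_cast [q]
    ring
  have h3 : (κ m).re + q ≤ ‖κ m + q‖ := by
    simpa using Complex.re_le_norm (κ m + q)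
  have h4 : ‖(κ m + q) * d m‖ ≤ q * ‖d m‖ := by
    rw [h1, Finset.sum_mul]
    refine (norm_sum_le _ _).trans (Finset.sum_le_sum fun z hz => ?_)
    have h0 := hG.offDiag_nonneg m z (Finset.ne_of_mem_erase hz).symm
    rw [norm_mul, Complex.norm_real, Real.norm_of_nonneg h0]
    exact mul_le_mul_of_nonneg_left (hm z) h0
  rw [norm_mul] at h4
  have h5 := mul_le_mul_of_nonneg_right h3 (norm_nonneg (d m))
  by_contra hpos
  nlinarith [mul_pos (hκ m) (not_le.1 hpos)]

variable {S : Finset ℝ} {Ω : Type*} [MeasurableSpace Ω] {G : Matrix S S ℝ}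
  {P : S → Measure Ω} {Y : ℝ≥0 → Ω → S} {k : S → S → ℂ}

lemma drawdown_domain_anti (a : ℝ) :
    ∀ x m m' : S, m ≤ m' → (m' : ℝ) - x < a → (m : ℝ) - x < a := fun x m m' h h' => by
  have : (m : ℝ) ≤ m' := h
  linarith

lemma IsCTMC.drawdown_decomposition_of_pos (hY : IsCTMC G P Y) {a : ℝ} (ha : 0 < a) (f : S → ℝ)
    (hk : ∀ x y, 0 < (k x y).re) (x : S) :
    exitMean P Y (fun x m => (m : ℝ) - x < a) k f x x =
      exitMean P Y (fun z _ => (z : ℝ) ∈ Ioc ((x : ℝ) - a) x) (fun z _ => k z x)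
        (fun z => if (z : ℝ) ≤ (x : ℝ) - a then f z else 0) x x +
      ∑ v : S with x < v,
        exitMean P Y (fun z _ => (z : ℝ) ∈ Ioc ((x : ℝ) - a) x) k
          (fun w => if (x : ℝ) < w then (if w = v then 1 else 0) else 0) x x *
        exitMean P Y (fun x m => (m : ℝ) - x < a) k f v v := by
  have hk0 : ∀ x y, 0 ≤ (k x y).re := fun x y => (hk x y).le
  set A : S → S → Prop := fun z _ => (z : ℝ) ∈ Ioc ((x : ℝ) - a) x
  set D : S → S → Prop := fun x m => (m : ℝ) - x < a
  have hDanti : ∀ x m m', m ≤ m' → D x m' → D x m := drawdown_domain_anti a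
  have hAanti : ∀ x m m', m ≤ m' → A x m' → A x m := fun _ _ _ _ h => h
  -- With initial maximum x ⊔ z, which is x throughout (x-a, x], the generator equations close up as
  -- a system in z alone.
  set w : S → ℂ := fun z => exitMean P Y D k f z (x ⊔ z)
  set p : S → ℂ := fun z => exitMean P Y A (fun z _ => k z x)
    (fun z => if (z : ℝ) ≤ (x : ℝ) - a then f z else 0) z (x ⊔ z)
  set s : S → S → ℂ := fun v z => exitMean P Y A k
    (fun w => if (x : ℝ) < w then (if w = v then 1 else 0) else 0) z (x ⊔ z)
  set c : S → ℂ := fun v => exitMean P Y D k f v v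
  have key := hY.isRateMatrix.eq_zero_of_generator (A := fun z => A z z)
    (κ := fun z => k z x) (d := fun z => w z - p z - ∑ v : S with x < v, s v z * c v)
    (fun z => hk z x) ?_ ?_ x
  · have : w x = p x + ∑ v : S with x < v, s v x * c v := by
      linear_combination key
    simpa only [w, p, s, c, sup_idem] using this
  · intro z hz
    have hs : ∀ v, s v z =
        ((if (x : ℝ) < z then (if z = v then 1 else 0) else 0 : ℝ) : ℂ) := fun v =>
      hY.exitMean_boundary (D := A) le_sup_right hz
    have hp : p z = ((if (z : ℝ) ≤ (x : ℝ) - a then f z else 0 : ℝ) : ℂ) :=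
      hY.exitMean_boundary (D := A) le_sup_right hz
    rcases lt_or_ge x z with hxz | hzx
    · have hxz' : (x : ℝ) < z := hxz
      -- Above x the start is itself the maximum, so the drawdown problem restarts from (z, z).
      have hw : w z = c z := by simp only [w, c, sup_eq_right.2 hxz.le]
      have hsum : ∑ v : S with x < v, s v z * c v = c z := by
        rw [Finset.sum_eq_single z]
        · simp [hs, hxz']
        · intro v _ hv
          simp [hs, hv.symm]
        · intro hz
          simp [hxz] at hz
      have hp0 : p z = 0 := by
        rw [hp, if_neg (by linarith)]
        simp
      rw [hsum, hw, hp0]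
      ring
    · have hzx' : (z : ℝ) ≤ x := hzx
      have hza : (z : ℝ) ≤ (x : ℝ) - a := by
        by_contra hcon
        exact hz ⟨not_le.1 hcon, hzx'⟩
      have hw : w z = f z := by
        refine hY.exitMean_boundary (D := D) le_sup_right ?_
        simp only [D, sup_eq_left.2 hzx]
        linarith
      simp [hs, hp, hw, hza, not_lt.2 hzx]
  · intro z hz
    have hzx : z ≤ x := hz.2
    have hsup : x ⊔ z = x := sup_eq_left.2 hzx
    have hwz : k z x * w z = ∑ v : S, (G z v : ℂ) * w v := by
      have hin : D z x := by
        have := hz.1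
        simp only [D]
        linarith
      have := hY.exitMean_generator (g := f) hDanti hk0 hzx hin
      simpa only [w, hsup] using this
    have hpz : k z x * p z = ∑ v : S, (G z v : ℂ) * p v := by
      have := hY.exitMean_generator (D := A) (k := fun z _ => k z x)
        (g := fun z => if (z : ℝ) ≤ (x : ℝ) - a then f z else 0) hAanti
        (fun z _ => hk0 z x) hzx hz
      simpa only [p, hsup] using this
    have hsz : ∀ u, k z x * s u z = ∑ v : S, (G z v : ℂ) * s u v := fun u => by
      have := hY.exitMean_generator (D := A) (k := k)
        (g := fun w => if (x : ℝ) < w then (if w = u then 1 else 0) else 0) hAanti hk0 hzx hz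
      simpa only [s, hsup] using this
    simp only [mul_sub, Finset.sum_sub_distrib, hwz, hpz, Finset.mul_sum]
    congr 1
    rw [Finset.sum_comm]
    refine Finset.sum_congr rfl fun u _ => ?_
    rw [← mul_assoc, hsz, Finset.sum_mul]
    exact Finset.sum_congr rfl fun v _ => by ring

/-- Without killing the linear system may have several solutions, for instance if (x-a, x] contains
an absorbing state, so the identity is obtained as the limit δ ↓ 0 of the killed one. -/
lemma IsCTMC.drawdown_decomposition (hY : IsCTMC G P Y) {a : ℝ} (ha : 0 < a) (f : S → ℝ)
    (hk : ∀ x y, 0 ≤ (k x y).re) (x : S) :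
    exitMean P Y (fun x m => (m : ℝ) - x < a) k f x x =
      exitMean P Y (fun z _ => (z : ℝ) ∈ Ioc ((x : ℝ) - a) x) (fun z _ => k z x)
        (fun z => if (z : ℝ) ≤ (x : ℝ) - a then f z else 0) x x +
      ∑ v : S with x < v,
        exitMean P Y (fun z _ => (z : ℝ) ∈ Ioc ((x : ℝ) - a) x) k
          (fun w => if (x : ℝ) < w then (if w = v then 1 else 0) else 0) x x *
        exitMean P Y (fun x m => (m : ℝ) - x < a) k f v v := by
  have hw : ∀ v : S, _ := fun v => hY.tendsto_exitMean_add_const (g := f)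
    (drawdown_domain_anti a) hk (le_refl v)
  have hp := hY.tendsto_exitMean_add_const
    (D := fun z _ => (z : ℝ) ∈ Ioc ((x : ℝ) - a) x) (k := fun z _ => k z x)
    (g := fun z => if (z : ℝ) ≤ (x : ℝ) - a then f z else 0) (fun _ _ _ _ h => h)
    (fun z _ => hk z x) (le_refl x)
  have hs : ∀ v : S, _ := fun v => hY.tendsto_exitMean_add_const
    (D := fun z _ => (z : ℝ) ∈ Ioc ((x : ℝ) - a) x)
    (g := fun w => if (x : ℝ) < w then (if w = v then 1 else 0) else 0) (fun _ _ _ _ h => h)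
    hk (le_refl x)
  refine tendsto_nhds_unique (hw x) ((hp.add (tendsto_finsetSum _ fun v _ =>
    (hs v).mul (hw v))).congr' ?_)
  filter_upwards [self_mem_nhdsWithin] with δ hδ
  refine (hY.drawdown_decomposition_of_pos ha f (k := fun x m => k x m + δ) (fun y m => ?_) x).symm
  simpa using add_pos_of_nonneg_of_pos (hk y m) hδ

end Decomposition

end DrawdownCTMC

theorem mainTheorem4 {S : Finset ℝ} {Ω : Type*} [MeasurableSpace Ω] (G : Matrix S S ℝ)
    (P : S → Measure Ω) (Y : ℝ≥0 → Ω → S) (hY : IsCTMC G P Y)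
    (a : ℝ) (ha : 0 < a) (f : S → ℝ)
    (k : S → S → ℂ) (hk : ∀ x y, 0 ≤ (k x y).re) :
    -- the linear system for `C` (with the expectations in it well defined)
    (∀ x : S,
      Integrable (drawdownVar Y x a k f) (P x) ∧
      Integrable (passageVar Y (Ioc ((x : ℝ) - a) x) (fun z => k z x)
        (fun z => if (z : ℝ) ≤ (x : ℝ) - a then f z else 0)) (P x) ∧
      drawdownC P Y a f k x =
        passageP P Y (Ioc ((x : ℝ) - a) x) (fun z => k z x) x
            (fun z => if (z : ℝ) ≤ (x : ℝ) - a then f z else 0) +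
          ∑ z : S with x < z,
            upcrossS P Y ((x : ℝ) - a) x k x x (fun w => if w = z then 1 else 0) *
              drawdownC P Y a f k z) ∧
    -- the linear system for `S_{(l, r]}` (with the expectations in it well defined)
    (∀ (l r : ℝ), l < r → ∀ (g : S → ℝ) (x y : S), x ≤ y →
      Integrable (upcrossVar Y y l r k g) (P x) ∧
      ((x : ℝ) ∈ Ioc l r →
        k x y * upcrossS P Y l r k x y g -
          ∑ z : S, (G x z : ℂ) * upcrossS P Y l r k z (y ⊔ z) g = 0) ∧
      ((x : ℝ) ∉ Ioc l r →
        upcrossS P Y l r k x y g = if r < (x : ℝ) then (g x : ℂ) else 0)) := by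
  have hpass : ∀ (y : S) (A : Set ℝ) (κ : S → ℂ) (g : S → ℝ), passageVar Y A κ g =
      exitVar Y y (fun x _ => (x : ℝ) ∈ A) (fun x _ => κ x) g := fun y A κ g =>
    funext fun ω => (hY.rightConst ω).passageVar_eq y A κ g
  have hup : ∀ (y : S) (l r : ℝ), l < r → ∀ (k : S → S → ℂ) (g : S → ℝ), upcrossVar Y y l r k g =
      exitVar Y y (fun x _ => (x : ℝ) ∈ Ioc l r) k (fun x => if r < (x : ℝ) then g x else 0) :=
    fun y l r hlr k g => funext fun ω => (hY.rightConst ω).upcrossVar_eq y hlr k g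
  refine ⟨fun x => ⟨?_, ?_, ?_⟩, fun l r hlr g x y hxy => ⟨?_, fun hx => ?_, fun hx => ?_⟩⟩
  · rw [drawdownVar_eq]
    exact hY.integrable_exitVar (drawdown_domain_anti a) hk le_rfl
  · rw [hpass x]
    exact hY.integrable_exitVar (fun _ _ _ _ h => h) (fun z _ => hk z x) le_rfl
  · simp only [drawdownC, passageP, upcrossS, drawdownVar_eq, hpass x,
      hup x ((x : ℝ) - a) x (by linarith)]
    exact hY.drawdown_decomposition ha f hk x
  · rw [hup y l r hlr]
    exact hY.integrable_exitVar (fun _ _ _ _ h => h) hk hxy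
  · simp only [upcrossS, hup _ l r hlr]
    exact sub_eq_zero.2 (hY.exitMean_generator
      (D := fun x _ => (x : ℝ) ∈ Ioc l r) (fun _ _ _ _ h => h) hk hxy hx)
  · simp only [upcrossS, hup _ l r hlr]
    have := hY.exitMean_boundary (D := fun x _ => (x : ℝ) ∈ Ioc l r) (k := k)
      (g := fun x => if r < (x : ℝ) then g x else 0) hxy hx
    rw [exitMean] at this
    rw [this]
    split_ifs <;> simp
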